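/- Let $n\ge 2$, write $[m]_q=1+q+\cdots+q^{m-1}$, and let $\Phi_n\in\mathbb{Q}[[q]]$ be the $q$-deformed metallic number, i.e. the value, in the $q$-adic topology of $\mathbb{Q}((q))$, of the $2$-periodic continued fraction $$\Phi_n(q)=[n]_q+\cfrac{q^n}{[n]_{q^{-1}}+\cfrac{q^{-n}}{[n]_q+\cfrac{q^n}{[n]_{q^{-1}}+\cfrac{q^{-n}}{[n]_q+\cdots}}}} ,$$ which converges to a power series. For a power series $F=\sum_{i\ge0} f_iq^i$ put $F^{(\ell)}=\sum_{i\ge0}f_{i+\ell}q^i$. For a continued fraction with partial numerators $a_i$ and partial denominators $b_i$, write $$\frac{a_0}{b_0}+\frac{a_1}{b_1}+\frac{a_2}{b_2}+\cdots\qquad\text{for}\qquad \cfrac{a_0}{b_0+\cfrac{a_1}{b_1+\cfrac{a_2}{b_2+\cdots}}}.$$ An (infinite) $H$-fraction expansion of $F$ is a continued fraction converging $q$-adically to $F$ with polynomial terms of the form $$a_0=v_0q^{k_0},\qquad a_{i+1}=-v_{i+1}q^{k_i+k_{i+1}+2},\qquad b_i(0)=1,\qquad \deg b_i\le k_i+1,\qquad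 v_i\in\mathbb{Q}^*,\ k_i\in\mathbb{Z}_{\ge0}.$$ Let $\langle n\rangle_q=q[n]_q+(1+q^n)(1-q)$, and consider the following three finite lists of terms (numerator, denominator). * $U_n$: for $i=0,1,\dots,n-3$ successively, $(q^{n-i},[n-i]_q)$, $(q^n,[i+2]_q-q)$, $(q^{i+2},1-q)$; then $(q^2,[2]_q)$, $(q^n,[n]_q-q)$, $(q^n,1)$. * $V_n$: $(-q^{n+1},\langle n\rangle_q+q^{n+1})$, $(q^{2n+1},\langle n\rangle_q)$, $(q^{2n+1},\langle n\rangle_q+q^{n+1})$, $(-q^{n+1},1)$. * $W_n$: for $i=0,1,\dots,n-3$ successively, $(q^{n-i},[n-i]_q-q)$, $(q^n,[i+2]_q)$, $(q^{i+2},1-q)$; then $(q^2,1)$. (For $n=2$ there is no index $i$.) Let $(\alpha_0,\beta_0)=(1,1-q)$, and let $(\alpha_i,\beta_i)_{i\ge1}$ be the $(6n-4)$-periodic sequence obtained by repeating indefinitely the concatenation of $U_n,V_n,W_n$. Then the $H$-fraction expansion of $\Phi_n$ is $$\Phi_n(q)=\frac{1}{\beta_0}+\frac{\alpha_1}{\beta_1}+\frac{\alpha_2}{\beta_2}+\cdots,$$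 and, for $1\le\ell\le n+1$, the $H$-fraction expansion of the shifted series $\Phi_n^{(\ell)}$ is $$\Phi_n^{(\ell)}(q)=\frac{1}{\beta_{3\ell}}+\frac{\alpha_{3\ell+1}}{\beta_{3\ell+1}}+\frac{\alpha_{3\ell+2}}{\beta_{3\ell+2}}+\cdots\qquad(1\le\ell\le n-1),$$ $$\Phi_n^{(n)}(q)=\frac{q^n}{\beta_{3n-1}}+\frac{\alpha_{3n}}{\beta_{3n}}+\frac{\alpha_{3n+1}}{\beta_{3n+1}}+\cdots,$$ $$\Phi_n^{(n+1)}(q)=\frac{q^{n-1}}{\beta_{3n}}+\frac{\alpha_{3n+1}}{\beta_{3n+1}}+\frac{\alpha_{3n+2}}{\beta_{3n+2}}+\cdots.$$ -/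

import Mathlib

open Filter Topology Polynomial PowerSeries

noncomputable section

namespace QMetallic

/-- The Euler–Gauss `q`-integer `[n]_x = 1 + x + ⋯ + x ^ (n - 1)`. -/
def qInt {R : Type*} [Semiring R] (x : R) (n : ℕ) : R := ∑ i ∈ Finset.range n, x ^ i

/-- `cfConvergent a b k` is the value `a 0 / (b 0 + a 1 / (b 1 + ⋯ + a (k - 1) / b (k - 1)))`
of the continued fraction truncated after `k` terms (`0` when `k = 0`). -/
def cfConvergent {K : Type*} [Field K] : (ℕ → K) → (ℕ → K) → ℕ → K
  | _, _, 0 => 0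
  | a, b, k + 1 =>
    a 0 / (b 0 + cfConvergent (fun i => a (i + 1)) (fun i => b (i + 1)) k)

open LaurentSeries WithZero MonoidWithZeroHom.ValueGroup₀ in
/-- Convergence for the `q`-adic topology means that the coefficients below any given degree are
eventually equal to those of the limit. -/
theorem tendsto_laurent_iff (c : ℕ → LaurentSeries ℚ) (F : LaurentSeries ℚ) :
    Tendsto c atTop (𝓝 F) ↔
      ∀ N : ℤ, ∀ᶠ k in atTop, ∀ i < N, (c k).coeff i = F.coeff i := by
  constructor
  · intro h N
    obtain ⟨x, hx⟩ := LaurentSeries.valuation_surjective ℚ (exp (-N))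
    have hx0 : Valued.v.restrict x ≠ 0 := fun h0 => (exp_ne_zero (a := -N))
      (hx ▸ MonoidWithZeroHom.ValueGroup₀.restrict₀_eq_zero_iff.1 h0)
    have hmem : {y : LaurentSeries ℚ | Valued.v (y - F) < exp (-N)} ∈ 𝓝 F := by
      refine Valued.mem_nhds.mpr ⟨Units.mk0 (Valued.v.restrict x) hx0, fun y hy => ?_⟩
      have hy' : Valued.v.restrict (y - F) < Valued.v.restrict x := hy
      rw [Valuation.restrict_lt_iff] at hy'
      exact hx ▸ hy'
    filter_upwards [h hmem] with k hk i hi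
    exact eq_coeff_of_valuation_sub_lt ℚ (le_of_lt hk) hi
  · intro h U hU
    obtain ⟨γ, hγ⟩ := Valued.mem_nhds.mp hU
    have hD : exp (-(-(log (embedding γ.1) - 1))) < embedding γ.1 := by
      rw [← lt_log_iff_exp_lt (by simp)]
      simp
    change ∀ᶠ k in atTop, c k ∈ U
    filter_upwards [h (-(log (embedding γ.1) - 1))] with k hk
    refine hγ ?_
    simp only [Set.mem_ofPred_eq, Valuation.restrict_lt_iff_lt_embedding]
    refine lt_of_le_of_lt ((valuation_le_iff_coeff_lt_eq_zero ℚ).mpr fun i hi => ?_) hD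
    rw [HahnSeries.coeff_sub, sub_eq_zero, hk i hi]

/-- The infinite continued fraction `a 0 / (b 0 + a 1 / (b 1 + a 2 / (b 2 + ⋯)))` converges to the
formal Laurent series `F` for the `q`-adic topology. -/
def CFConverges (a b : ℕ → LaurentSeries ℚ) (F : LaurentSeries ℚ) : Prop :=
  Tendsto (cfConvergent a b) atTop (𝓝 F)

/-- The indeterminate `q` as a Laurent series. -/
def qL : LaurentSeries ℚ := HahnSeries.single (1 : ℤ) (1 : ℚ)

/-- The partial numerators `q ^ n, q ^ (-n), q ^ n, q ^ (-n), …` in the continued fraction which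
defines the `q`-metallic number. -/
def metallicNum (n : ℕ) (j : ℕ) : LaurentSeries ℚ := if Even j then qL ^ n else qL⁻¹ ^ n

/-- The partial denominators `[n]_{q⁻¹}, [n]_q, [n]_{q⁻¹}, [n]_q, …` in the continued fraction which
defines the `q`-metallic number. -/
def metallicDen (n : ℕ) (j : ℕ) : LaurentSeries ℚ := if Even j then qInt qL⁻¹ n else qInt qL n

/-- `Φ` is the value of the `2`-periodic continued fraction
`[n]_q + q ^ n / ([n]_{q⁻¹} + q ^ (-n) / ([n]_q + q ^ n / ([n]_{q⁻¹} + ⋯)))`. -/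
def IsQMetallic (n : ℕ) (Φ : ℚ⟦X⟧) : Prop :=
  CFConverges (metallicNum n) (metallicDen n) ((Φ : LaurentSeries ℚ) - qInt qL n)

/-- The `q`-metallic number `Φ_n`: the power series which is the value of the `2`-periodic continued
fraction above. (Limits of Laurent series are unique.) -/
def qMetallic (n : ℕ) : ℚ⟦X⟧ := Classical.epsilon (IsQMetallic n)

/-- The shifted series `F^(ℓ) = f_ℓ + f_(ℓ+1) q + f_(ℓ+2) q² + ⋯`. -/
def shift (F : ℚ⟦X⟧) (ℓ : ℕ) : ℚ⟦X⟧ := PowerSeries.mk fun i => PowerSeries.coeff (i + ℓ) F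

/-- The continued fraction with partial numerators `a` and partial denominators `b` has the shape of
an (infinite) `H`-fraction
`v 0 q ^ k 0 / (D 0 + (- v 1 q ^ (k 0 + k 1 + 2)) / (D 1 + (- v 2 q ^ (k 1 + k 2 + 2)) / (D 2 + ⋯)))`
with `v i ≠ 0`, `D i (0) = 1` and `deg (D i) ≤ k i + 1`. -/
def IsHFraction (a b : ℕ → ℚ[X]) : Prop :=
  ∃ (v : ℕ → ℚ) (k : ℕ → ℕ),
    (∀ i, v i ≠ 0) ∧
    a 0 = Polynomial.C (v 0) * Polynomial.X ^ k 0 ∧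
    (∀ i, a (i + 1) = -Polynomial.C (v (i + 1)) * Polynomial.X ^ (k i + k (i + 1) + 2)) ∧
    ∀ i, (b i).eval 0 = 1 ∧ (b i).natDegree ≤ k i + 1

/-- A polynomial in `q` seen as a Laurent series. -/
def toLaurent (p : ℚ[X]) : LaurentSeries ℚ := ((p : ℚ⟦X⟧) : LaurentSeries ℚ)

/-- `a 0 / (b 0 + a 1 / (b 1 + ⋯))` is the `H`-fraction expansion of the power series `F`. -/
def HasHFraction (F : ℚ⟦X⟧) (a b : ℕ → ℚ[X]) : Prop :=
  IsHFraction a b ∧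
    CFConverges (fun i => toLaurent (a i)) (fun i => toLaurent (b i)) (F : LaurentSeries ℚ)

/-- The polynomial `⟨n⟩_q = q [n]_q + (1 + q ^ n) (1 - q)`. -/
def qAngle (n : ℕ) : ℚ[X] :=
  Polynomial.X * qInt Polynomial.X n + (1 + Polynomial.X ^ n) * (1 - Polynomial.X)

/-- The terms (partial numerator, partial denominator) of `U_n`. -/
def blockU (n : ℕ) : List (ℚ[X] × ℚ[X]) :=
  ((List.range (n - 2)).flatMap fun i =>
    [(Polynomial.X ^ (n - i), qInt Polynomial.X (n - i)),
     (Polynomial.X ^ n, qInt Polynomial.X (i + 2) - Polynomial.X),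
     (Polynomial.X ^ (i + 2), 1 - Polynomial.X)]) ++
  [(Polynomial.X ^ 2, qInt Polynomial.X 2),
   (Polynomial.X ^ n, qInt Polynomial.X n - Polynomial.X),
   (Polynomial.X ^ n, 1)]

/-- The terms of `V_n`. -/
def blockV (n : ℕ) : List (ℚ[X] × ℚ[X]) :=
  [(-Polynomial.X ^ (n + 1), qAngle n + Polynomial.X ^ (n + 1)),
   (Polynomial.X ^ (2 * n + 1), qAngle n),
   (Polynomial.X ^ (2 * n + 1), qAngle n + Polynomial.X ^ (n + 1)),
   (-Polynomial.X ^ (n + 1), 1)]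

/-- The terms of `W_n`. -/
def blockW (n : ℕ) : List (ℚ[X] × ℚ[X]) :=
  ((List.range (n - 2)).flatMap fun i =>
    [(Polynomial.X ^ (n - i), qInt Polynomial.X (n - i) - Polynomial.X),
     (Polynomial.X ^ n, qInt Polynomial.X (i + 2)),
     (Polynomial.X ^ (i + 2), 1 - Polynomial.X)]) ++
  [(Polynomial.X ^ 2, 1)]

/-- One period of the `H`-fraction of `Φ_n`: the terms of `U_n`, then `V_n`, then `W_n`. -/
def period (n : ℕ) : List (ℚ[X] × ℚ[X]) := blockU n ++ blockV n ++ blockW n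

theorem length_period (n : ℕ) (hn : 2 ≤ n) : (period n).length = 6 * n - 4 := by
  simp only [period, blockU, blockV, blockW, List.length_append, List.length_flatMap,
    List.length_cons, List.length_nil, List.map_const', List.length_range, List.sum_replicate,
    smul_eq_mul]
  omega

/-- The terms of the continued fraction `1 / (1 - q) + (U_n + V_n + W_n +)^*`, which is
`(6 n - 4)`-periodic with offset `1`. -/
def hTerm (n : ℕ) : ℕ → ℚ[X] × ℚ[X]
  | 0 => (1, 1 - Polynomial.X)
  | i + 1 => (period n).getD (i % (6 * n - 4)) (0, 0)

/-- The partial numerators `α_0 = 1, α_1, α_2, …`. -/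
def hNum (n i : ℕ) : ℚ[X] := (hTerm n i).1

/-- The partial denominators `β_0, β_1, β_2, …`. -/
def hDen (n i : ℕ) : ℚ[X] := (hTerm n i).2

/-- The partial numerators left when the first `m` terms are deleted and the first remaining
numerator is replaced by `c`, that is `c, a (m + 1), a (m + 2), …`. -/
def cutNum (a : ℕ → ℚ[X]) (m : ℕ) (c : ℚ[X]) : ℕ → ℚ[X]
  | 0 => c
  | i + 1 => a (m + (i + 1))

/-- The partial denominators left when the first `m` terms are deleted: `b m, b (m + 1), …`. -/
def cutDen (b : ℕ → ℚ[X]) (m : ℕ) (i : ℕ) : ℚ[X] := b (m + i)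

end QMetallic

end

/-!
Every tail of the continued fraction is written down explicitly. Let `ψ` be the power series with
`ψ (⟨n⟩_q + q ^ (2 n + 1) ψ) = 1` (`IsMetallicRemainder`); it exists because `ψ ↦ 1 / (A + q C ψ)`
is a `q`-adic contraction. Then `Φ = [n]_q + q ^ (2 n) ψ` satisfies the fixed point equation
`Φ = [n]_q + q ^ (2 n) / (q [n]_q + 1 / Φ)` of the `2`-periodic continued fraction, whose
convergents are power series approaching `Φ - [n]_q`, so that `Φ` is the `q`-metallic number
(`IsMetallicRemainder.isQMetallic`). Its shifts are `[n - l]_q + q ^ (2 n - l) ψ` for `l ≤ n`, and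
`q ^ (n - 1) ψ` for `l = n + 1`.

The tails of the `H`-fraction are rational expressions in `q` and `ψ`, listed in `Stage`. At the
start of the triple of index `i` of `U_n`, the tail is `1 / Φ^(i) - (1 - q)`; the next ones are
`q ^ n ψ / (1 - (1 - q) q ^ n ψ)`, which does not depend on `i`, and `q ^ (i + 2) Φ^(i + 1)`. The
tails in `V_n` are `1 / Φ^(n - 1) - 1`, then twice `q ^ (2 n + 1) ψ`, then
`q ^ (2 n + 1) ψ - q ^ (n + 1)`, and at the start of the triple of index `i` of `W_n` the tail is
`q ^ (n - i) ψ / (1 - [i + 1]_q q ^ (n - i) ψ)`. The relation `F = a / (b + F')` between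
consecutive tails is in each case a polynomial identity modulo the equation of `ψ`, and the end
of the period leads back to its beginning (`Stage.exists_step`). As all tails vanish at `q = 0`
and all partial denominators are `1` there, each step brings the convergents closer to the value
(`cfConverges_of_tails`). `Stage` also carries the exponents `k`, which shows the shape of an
`H`-fraction, and a cut of the continued fraction is treated by starting at another entry of the
list (`Stage.hasHFraction`).
-/

namespace QMetallic

/-! ### Continued fractions of power series and `q`-adic convergence -/

/-- A sequence of convergents that are power series agreeing with `F` to higher and higher order
converges to `F`. -/
theorem cfConverges_of_X_pow_dvd {a b : ℕ → LaurentSeries ℚ} {F : ℚ⟦X⟧}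
    (h : ∀ k, ∃ p : ℚ⟦X⟧, cfConvergent a b (k + 1) = (p : LaurentSeries ℚ) ∧
      (PowerSeries.X : ℚ⟦X⟧) ^ k ∣ p - F) :
    CFConverges a b (F : LaurentSeries ℚ) := by
  refine (tendsto_laurent_iff _ _).2 fun N => eventually_atTop.2 ⟨N.toNat + 1, ?_⟩
  intro k hk i hi
  obtain ⟨k, rfl⟩ : ∃ j, k = j + 1 := ⟨k - 1, by omega⟩
  obtain ⟨p, hp, hd⟩ := h k
  rw [hp, PowerSeries.coeff_coe, PowerSeries.coeff_coe]
  split_ifs with hi0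
  · rfl
  · have := PowerSeries.X_pow_dvd_iff.1 hd i.natAbs (by omega)
    rwa [map_sub, sub_eq_zero] at this

theorem CFConverges.unique {a b : ℕ → LaurentSeries ℚ} {F G : LaurentSeries ℚ}
    (hF : CFConverges a b F) (hG : CFConverges a b G) : F = G := by
  ext i
  obtain ⟨k, hk₁, hk₂⟩ := (((tendsto_laurent_iff _ _).1 hF (i + 1)).and
    ((tendsto_laurent_iff _ _).1 hG (i + 1))).exists
  rw [← hk₁ i (by omega), ← hk₂ i (by omega)]

theorem coe_powerSeries_ne_zero {D : ℚ⟦X⟧} (hD : PowerSeries.constantCoeff D ≠ 0) :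
    (D : LaurentSeries ℚ) ≠ 0 := by
  intro h
  rw [← PowerSeries.coe_zero] at h
  exact hD (by rw [HahnSeries.ofPowerSeries_injective h, map_zero])

theorem coe_powerSeries_div {N D : ℚ⟦X⟧} (hD : PowerSeries.constantCoeff D ≠ 0) :
    (N : LaurentSeries ℚ) / (D : LaurentSeries ℚ) = ((N * D⁻¹ : ℚ⟦X⟧) : LaurentSeries ℚ) := by
  rw [div_eq_iff (coe_powerSeries_ne_zero hD), ← PowerSeries.coe_mul, mul_assoc,
    PowerSeries.inv_mul_cancel _ hD, mul_one]

/-- If power series `F i` without constant term satisfy `F i = a i / (b i + F (i + 1))`, where the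
`b i` have constant term `1`, then the `k`-th convergent agrees with `F 0` up to order `k`:
each step multiplies the error by `F i`, up to a unit. -/
theorem exists_cfConvergent_eq (k : ℕ) : ∀ a b F : ℕ → ℚ⟦X⟧,
    (∀ i, PowerSeries.constantCoeff (F i) = 0) → (∀ i, PowerSeries.constantCoeff (b i) = 1) →
    (∀ i, F i * (b i + F (i + 1)) = a i) →
    ∃ p : ℚ⟦X⟧,
      cfConvergent (fun i => (a i : LaurentSeries ℚ)) (fun i => (b i : LaurentSeries ℚ)) k =
        (p : LaurentSeries ℚ) ∧
      PowerSeries.constantCoeff p = 0 ∧ (PowerSeries.X : ℚ⟦X⟧) ^ k ∣ p - F 0 := by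
  induction k with
  | zero => exact fun a b F _ _ _ => ⟨0, by simp [cfConvergent], by simp, by simp⟩
  | succ k ih =>
    intro a b F hF hb h
    obtain ⟨p, hp, hp0, hpd⟩ := ih (fun i => a (i + 1)) (fun i => b (i + 1)) (fun i => F (i + 1))
      (fun i => hF _) (fun i => hb _) (fun i => h _)
    have hD : PowerSeries.constantCoeff (b 0 + p) ≠ 0 := by simp [hb, hp0]
    refine ⟨a 0 * (b 0 + p)⁻¹, ?_, ?_, ?_⟩
    · rw [cfConvergent, hp, ← PowerSeries.coe_add, coe_powerSeries_div hD]
    · rw [map_mul, ← h 0, map_mul, hF, zero_mul, zero_mul]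
    · have e : a 0 * (b 0 + p)⁻¹ - F 0 = F 0 * (p - F 1) * (-(b 0 + p)⁻¹) := by
        linear_combination (-(b 0 + p)⁻¹) * h 0 + F 0 * PowerSeries.mul_inv_cancel _ hD
      rw [e, pow_succ']
      exact (mul_dvd_mul (PowerSeries.X_dvd_iff.2 (hF 0)) hpd).mul_right _

/-- Convergence of a continued fraction `a 0 / (b 0 + a 1 / (b 1 + ⋯))` to `G`, from its tails
`F i = a (i + 1) / (b (i + 1) + ⋯)`. -/
theorem cfConverges_of_tails {a b : ℕ → ℚ[X]} {F : ℕ → ℚ⟦X⟧} {G : ℚ⟦X⟧}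
    (hF : ∀ i, PowerSeries.constantCoeff (F i) = 0) (hb : ∀ i, (b i).eval 0 = 1)
    (h0 : G * (b 0 + F 0) = a 0)
    (h : ∀ i, F i * (b (i + 1) + F (i + 1)) = a (i + 1)) :
    CFConverges (fun i => toLaurent (a i)) (fun i => toLaurent (b i)) (G : LaurentSeries ℚ) := by
  have hb' (i : ℕ) : PowerSeries.constantCoeff (b i : ℚ⟦X⟧) = 1 := by
    rw [Polynomial.constantCoeff_coe, Polynomial.coeff_zero_eq_eval_zero, hb]
  refine cfConverges_of_X_pow_dvd fun k => ?_
  obtain ⟨p, hp, hp0, hpd⟩ := exists_cfConvergent_eq k (fun i => (a (i + 1) : ℚ⟦X⟧))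
    (fun i => (b (i + 1) : ℚ⟦X⟧)) F hF (fun i => hb' _) h
  have hD : PowerSeries.constantCoeff ((b 0 : ℚ⟦X⟧) + p) ≠ 0 := by simp [hb' 0, hp0]
  refine ⟨a 0 * (b 0 + p)⁻¹, ?_, ?_⟩
  · rw [cfConvergent]
    simp only [toLaurent]
    rw [hp, ← PowerSeries.coe_add, coe_powerSeries_div hD]
  · have e : a 0 * ((b 0 : ℚ⟦X⟧) + p)⁻¹ - G = (p - F 0) * (-(G * ((b 0 : ℚ⟦X⟧) + p)⁻¹)) := by
      linear_combination (-((b 0 : ℚ⟦X⟧) + p)⁻¹) * h0 + G * PowerSeries.mul_inv_cancel _ hD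
    rw [e]
    exact hpd.mul_right _

/-- A quadratic equation `ψ (A + q C ψ) = 1` with `A(0) = 1` has a power series solution, the fixed
point of the `q`-adic contraction `ψ ↦ 1 / (A + q C ψ)`. -/
theorem exists_mul_add_X_mul_eq_one (A C : ℚ⟦X⟧) (hA : PowerSeries.constantCoeff A = 1) :
    ∃ ψ : ℚ⟦X⟧, ψ * (A + PowerSeries.X * C * ψ) = 1 := by
  have hinv (f : ℚ⟦X⟧) : ∃ g : ℚ⟦X⟧, g * (A + PowerSeries.X * C * f) = 1 := by
    have hD : PowerSeries.constantCoeff (A + PowerSeries.X * C * f) ≠ 0 := by simp [hA]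
    exact ⟨_, PowerSeries.inv_mul_cancel _ hD⟩
  choose T hmul using hinv
  have hsub (f g : ℚ⟦X⟧) : T f - T g = PowerSeries.X * (f - g) * (-C * T f * T g) := by
    linear_combination T g * hmul f - T f * hmul g
  obtain ⟨c, hc⟩ : ∃ c : ℕ → ℚ⟦X⟧, ∀ k, c (k + 1) = T (c k) :=
    ⟨fun k => Nat.rec 0 (fun _ f => T f) k, fun _ => rfl⟩
  have hstep (k : ℕ) : (PowerSeries.X : ℚ⟦X⟧) ^ k ∣ c (k + 1) - c k := by
    induction k with
    | zero => simp
    | succ k ih =>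
      have e : c (k + 1 + 1) - c (k + 1) = T (c (k + 1)) - T (c k) := by rw [hc, ← hc k]
      rw [e, hsub, pow_succ']
      exact (mul_dvd_mul_left _ ih).mul_right _
  have hlong (k j : ℕ) : (PowerSeries.X : ℚ⟦X⟧) ^ k ∣ c (k + j) - c k := by
    induction j with
    | zero => simp
    | succ j ih =>
      have := dvd_add ((pow_dvd_pow _ (Nat.le_add_right k j)).trans (hstep (k + j))) ih
      rwa [sub_add_sub_cancel] at this
  let ψ : ℚ⟦X⟧ := PowerSeries.mk fun i => PowerSeries.coeff i (c (i + 1))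
  have hψ (k : ℕ) : (PowerSeries.X : ℚ⟦X⟧) ^ k ∣ ψ - c k := by
    refine PowerSeries.X_pow_dvd_iff.2 fun i hi => ?_
    have := PowerSeries.X_pow_dvd_iff.1 (hlong (i + 1) (k - (i + 1))) i (by omega)
    rw [Nat.add_sub_cancel' hi, map_sub, sub_eq_zero] at this
    rw [map_sub, PowerSeries.coeff_mk, this, sub_self]
  have hfix : ψ = T ψ := by
    ext k
    have h1 := hψ (k + 1)
    have h2 : (PowerSeries.X : ℚ⟦X⟧) ^ (k + 1) ∣ T ψ - c (k + 1) := by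
      rw [hc, hsub, pow_succ']
      exact (mul_dvd_mul_left _ (hψ k)).mul_right _
    have := PowerSeries.X_pow_dvd_iff.1 (dvd_sub h1 h2) k (by omega)
    rwa [sub_sub_sub_cancel_right, map_sub, sub_eq_zero] at this
  exact ⟨ψ, by conv_lhs => { lhs; rw [hfix] }
               exact hmul ψ⟩

/-! ### `q`-integers -/

theorem qInt_zero {R : Type*} [Semiring R] (x : R) : qInt x 0 = 0 := by simp [qInt]

theorem qInt_succ {R : Type*} [Semiring R] (x : R) (n : ℕ) :
    qInt x (n + 1) = qInt x n + x ^ n := by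
  simp [qInt, Finset.sum_range_succ]

theorem qInt_add {R : Type*} [CommSemiring R] (x : R) (m n : ℕ) :
    qInt x (m + n) = qInt x m + x ^ m * qInt x n := by
  simp [qInt, Finset.sum_range_add, Finset.mul_sum, pow_add]

theorem one_sub_mul_qInt {R : Type*} [CommRing R] (x : R) (n : ℕ) :
    (1 - x) * qInt x n = 1 - x ^ n :=
  mul_neg_geom_sum x n

theorem qInt_inv_mul_pow {K : Type*} [Field K] {x : K} (hx : x ≠ 0) (n : ℕ) :
    qInt x⁻¹ n * x ^ n = x * qInt x n := by
  induction n with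
  | zero => simp [qInt_zero]
  | succ n ih =>
    have h : x⁻¹ ^ n * x ^ n = 1 := by rw [← mul_pow, inv_mul_cancel₀ hx, one_pow]
    have e := qInt_add x 1 n
    rw [add_comm 1 n, qInt_succ x 0, qInt_zero] at e
    rw [e, qInt_succ x⁻¹]
    linear_combination x * ih + x * h

theorem map_qInt {R S F : Type*} [Semiring R] [Semiring S] [FunLike F R S] [RingHomClass F R S]
    (f : F) (x : R) (n : ℕ) : f (qInt x n) = qInt (f x) n := by
  simp [qInt]

theorem coe_qInt (n : ℕ) :
    ((qInt Polynomial.X n : ℚ[X]) : ℚ⟦X⟧) = qInt PowerSeries.X n := by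
  rw [← Polynomial.coeToPowerSeries.ringHom_apply, map_qInt,
    Polynomial.coeToPowerSeries.ringHom_apply, Polynomial.coe_X]

theorem laurent_coe_qInt (n : ℕ) :
    ((qInt PowerSeries.X n : ℚ⟦X⟧) : LaurentSeries ℚ) = qInt qL n := by
  rw [map_qInt, HahnSeries.ofPowerSeries_X, qL]

theorem constantCoeff_qInt_succ (n : ℕ) :
    PowerSeries.constantCoeff (qInt PowerSeries.X (n + 1) : ℚ⟦X⟧) = 1 := by
  rw [map_qInt]
  simp [qInt, Finset.sum_range_succ']

theorem eval_zero_qInt_succ (n : ℕ) : (qInt Polynomial.X (n + 1) : ℚ[X]).eval 0 = 1 := by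
  simp [qInt, Finset.sum_range_succ', Polynomial.eval_finsetSum]

theorem natDegree_qInt_succ_le (n : ℕ) : (qInt Polynomial.X (n + 1) : ℚ[X]).natDegree ≤ n := by
  refine Polynomial.natDegree_sum_le_of_forall_le _ _ fun i hi => ?_
  rw [Polynomial.natDegree_X_pow]
  exact Nat.lt_succ_iff.1 (Finset.mem_range.1 hi)

theorem coeff_qInt_of_le {n i : ℕ} (h : n ≤ i) :
    PowerSeries.coeff i (qInt PowerSeries.X n : ℚ⟦X⟧) = 0 := by
  rw [qInt, map_sum]
  refine Finset.sum_eq_zero fun j hj => ?_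
  rw [PowerSeries.coeff_X_pow, if_neg]
  have := Finset.mem_range.1 hj
  omega

/-! ### The `q`-metallic number and its shifts -/

theorem shift_qInt_add_X_pow_mul {m l : ℕ} (h : m ≤ l) (G : ℚ⟦X⟧) :
    shift (qInt PowerSeries.X m + PowerSeries.X ^ l * G) l = G := by
  ext i
  rw [shift, PowerSeries.coeff_mk, map_add, coeff_qInt_of_le (by omega), zero_add,
    PowerSeries.coeff_X_pow_mul]

/-- `ψ` is the power series with `ψ = 1 / (⟨n⟩_q + q ^ (2 n + 1) ψ)`; it is the part of `Φ_n`
beyond its initial segment, namely `Φ_n = [n]_q + q ^ (2 n) ψ`. -/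
def IsMetallicRemainder (n : ℕ) (ψ : ℚ⟦X⟧) : Prop :=
  ψ * (PowerSeries.X * qInt PowerSeries.X n + (1 + PowerSeries.X ^ n) * (1 - PowerSeries.X) +
    PowerSeries.X ^ (2 * n + 1) * ψ) = 1

theorem exists_isMetallicRemainder {n : ℕ} (hn : n ≠ 0) : ∃ ψ, IsMetallicRemainder n ψ := by
  obtain ⟨ψ, h⟩ := exists_mul_add_X_mul_eq_one
    (PowerSeries.X * qInt PowerSeries.X n + (1 + PowerSeries.X ^ n) * (1 - PowerSeries.X))
    (PowerSeries.X ^ (2 * n)) (by simp [hn])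
  exact ⟨ψ, by rw [IsMetallicRemainder, pow_succ', h]⟩

/-- With `Φ = [n]_q + q ^ (2 n) ψ` this reads `ψ = Φ / (q [n]_q Φ + 1)`, that is
`Φ = [n]_q + q ^ (2 n) / (q [n]_q + 1 / Φ)`, the fixed point equation of the `2`-periodic continued
fraction. -/
theorem IsMetallicRemainder.mul_qInt_mul_add_one {n : ℕ} {ψ : ℚ⟦X⟧} (h : IsMetallicRemainder n ψ) :
    ψ * (PowerSeries.X * qInt PowerSeries.X n *
      (qInt PowerSeries.X n + PowerSeries.X ^ (2 * n) * ψ) + 1) =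
      qInt PowerSeries.X n + PowerSeries.X ^ (2 * n) * ψ := by
  have h1 := one_sub_mul_qInt (PowerSeries.X : ℚ⟦X⟧) n
  rw [IsMetallicRemainder] at h
  linear_combination qInt PowerSeries.X n * h - ψ * (1 + PowerSeries.X ^ n) * h1

theorem qL_ne_zero : qL ≠ 0 := HahnSeries.single_ne_zero one_ne_zero

theorem coe_X_eq_qL : ((PowerSeries.X : ℚ⟦X⟧) : LaurentSeries ℚ) = qL :=
  HahnSeries.ofPowerSeries_X

theorem cfConvergent_metallic_one {n : ℕ} (hn : n ≠ 0) :
    cfConvergent (metallicNum n) (metallicDen n) 1 =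
      ((PowerSeries.X ^ (2 * n - 1) * (qInt PowerSeries.X n)⁻¹ : ℚ⟦X⟧) : LaurentSeries ℚ) := by
  obtain ⟨n, rfl⟩ := Nat.exists_eq_add_one_of_ne_zero hn
  have hB : PowerSeries.constantCoeff (qInt PowerSeries.X (n + 1) : ℚ⟦X⟧) ≠ 0 := by
    rw [constantCoeff_qInt_succ]; exact one_ne_zero
  rw [← coe_powerSeries_div hB]
  have hB0 : qInt qL (n + 1) ≠ 0 := by
    rw [← laurent_coe_qInt]
    exact coe_powerSeries_ne_zero hB
  have e := qInt_inv_mul_pow qL_ne_zero (n + 1)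
  have hA0 : qInt qL⁻¹ (n + 1) ≠ 0 := by
    intro h0
    rw [h0, zero_mul] at e
    exact mul_ne_zero qL_ne_zero hB0 e.symm
  simp only [cfConvergent, metallicNum, metallicDen, Even.zero, if_true, add_zero]
  rw [PowerSeries.coe_pow, coe_X_eq_qL, laurent_coe_qInt, div_eq_div_iff hA0 hB0]
  apply mul_left_cancel₀ qL_ne_zero
  rw [show 2 * (n + 1) - 1 = n + (n + 1) by omega]
  linear_combination (-qL ^ (n + 1)) * e

/-- Adding one period to a convergent `p` of the `2`-periodic continued fraction: since
`q ^ n [n]_{q⁻¹} = q [n]_q`, the negative powers of `q` cancel and the result is a power series. -/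
theorem cfConvergent_metallic_add_two {n k : ℕ} (hn : n ≠ 0) {p : ℚ⟦X⟧}
    (hp : PowerSeries.constantCoeff p = 0)
    (h : cfConvergent (metallicNum n) (metallicDen n) k = (p : LaurentSeries ℚ)) :
    cfConvergent (metallicNum n) (metallicDen n) (k + 2) =
      ((PowerSeries.X ^ (2 * n) * (qInt PowerSeries.X n + p) *
        (PowerSeries.X * qInt PowerSeries.X n * (qInt PowerSeries.X n + p) + 1)⁻¹ : ℚ⟦X⟧) :
          LaurentSeries ℚ) := by
  obtain ⟨n, rfl⟩ := Nat.exists_eq_add_one_of_ne_zero hn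
  have hnum : (fun i => metallicNum (n + 1) (i + 1 + 1)) = metallicNum (n + 1) := by
    ext1 i; simp [metallicNum, Nat.even_add_one]
  have hden : (fun i => metallicDen (n + 1) (i + 1 + 1)) = metallicDen (n + 1) := by
    ext1 i; simp [metallicDen, Nat.even_add_one]
  have hD : PowerSeries.constantCoeff (PowerSeries.X * qInt PowerSeries.X (n + 1) *
      (qInt PowerSeries.X (n + 1) + p) + 1 : ℚ⟦X⟧) ≠ 0 := by simp
  have hE : PowerSeries.constantCoeff (qInt PowerSeries.X (n + 1) + p : ℚ⟦X⟧) ≠ 0 := by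
    rw [map_add, constantCoeff_qInt_succ, hp, add_zero]; exact one_ne_zero
  rw [← coe_powerSeries_div hD]
  have hD0 := coe_powerSeries_ne_zero hD
  have hE0 := coe_powerSeries_ne_zero hE
  have e := qInt_inv_mul_pow qL_ne_zero (n + 1)
  have hq := pow_ne_zero (n + 1) qL_ne_zero
  rw [cfConvergent, cfConvergent, hnum, hden, h]
  simp only [metallicNum, metallicDen, Even.zero, if_true, zero_add, Nat.not_even_one, if_false]
  simp only [PowerSeries.coe_mul, PowerSeries.coe_add, PowerSeries.coe_one, PowerSeries.coe_pow,
    coe_X_eq_qL, laurent_coe_qInt] at hD0 hE0 ⊢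
  have e2 : qInt qL⁻¹ (n + 1) + qL⁻¹ ^ (n + 1) / (qInt qL (n + 1) + p) =
      (qL * qInt qL (n + 1) * (qInt qL (n + 1) + p) + 1) /
        (qL ^ (n + 1) * (qInt qL (n + 1) + p)) := by
    rw [← e, inv_pow]
    field_simp
  rw [e2, div_div_eq_mul_div, two_mul,
    pow_add _ (n + 1) (n + 1), ← mul_assoc]

theorem IsMetallicRemainder.isQMetallic {n : ℕ} (hn : n ≠ 0) {ψ : ℚ⟦X⟧}
    (h : IsMetallicRemainder n ψ) :
    IsQMetallic n (qInt PowerSeries.X n + PowerSeries.X ^ (2 * n) * ψ) := by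
  -- One period multiplies the error by `q ^ (2 n)` up to a power series factor.
  have key (k : ℕ) : (∃ p : ℚ⟦X⟧,
      cfConvergent (metallicNum n) (metallicDen n) k = (p : LaurentSeries ℚ) ∧
      PowerSeries.constantCoeff p = 0 ∧
      (PowerSeries.X : ℚ⟦X⟧) ^ k ∣ p - PowerSeries.X ^ (2 * n) * ψ) := by
    induction k using Nat.twoStepInduction with
    | zero => exact ⟨0, by simp [cfConvergent], by simp, by simp⟩
    | one =>
      refine ⟨_, cfConvergent_metallic_one hn, ?_, ?_⟩
      · rw [map_mul, map_pow, PowerSeries.constantCoeff_X, zero_pow (by omega), zero_mul]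
      · exact dvd_sub ((pow_dvd_pow _ (by omega)).mul_right _)
          ((pow_dvd_pow _ (by omega)).mul_right _)
    | more k ih _ =>
      obtain ⟨p, hp, hp0, hpd⟩ := ih
      refine ⟨_, cfConvergent_metallic_add_two hn hp0 hp, ?_, ?_⟩
      · simp [hn]
      · have hD : PowerSeries.constantCoeff (PowerSeries.X * qInt PowerSeries.X n *
          (qInt PowerSeries.X n + p) + 1 : ℚ⟦X⟧) ≠ 0 := by simp
        have hI := PowerSeries.mul_inv_cancel _ hD
        have h1 := h.mul_qInt_mul_add_one
        set I := (PowerSeries.X * qInt PowerSeries.X n *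
          (qInt PowerSeries.X n + p) + 1 : ℚ⟦X⟧)⁻¹
        have e : PowerSeries.X ^ (2 * n) * (qInt PowerSeries.X n + p) * I -
            PowerSeries.X ^ (2 * n) * ψ = (p - PowerSeries.X ^ (2 * n) * ψ) *
              PowerSeries.X ^ (2 * n) * ((1 - PowerSeries.X * qInt PowerSeries.X n * ψ) * I) := by
          linear_combination PowerSeries.X ^ (2 * n) * ψ * hI - PowerSeries.X ^ (2 * n) * I * h1
        rw [e, pow_add]
        exact (mul_dvd_mul hpd (pow_dvd_pow _ (by omega))).mul_right _
  have hc := cfConverges_of_X_pow_dvd (a := metallicNum n) (b := metallicDen n) fun k => by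
    obtain ⟨p, hp, _, hpd⟩ := key (k + 1)
    exact ⟨p, hp, (pow_dvd_pow _ k.le_succ).trans hpd⟩
  rw [IsQMetallic, PowerSeries.coe_add, laurent_coe_qInt, add_sub_cancel_left]
  exact hc

theorem isQMetallic_unique {n : ℕ} {Φ Φ' : ℚ⟦X⟧} (h : IsQMetallic n Φ) (h' : IsQMetallic n Φ') :
    Φ = Φ' :=
  HahnSeries.ofPowerSeries_injective (sub_left_injective (CFConverges.unique h h'))

theorem isQMetallic_qMetallic {n : ℕ} {Φ : ℚ⟦X⟧} (h : IsQMetallic n Φ) :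
    IsQMetallic n (qMetallic n) :=
  Classical.epsilon_spec ⟨Φ, h⟩

/-! ### The terms of one period -/

theorem getD_flatMap_range_triple {α : Type*} (f g h : ℕ → α) (d : α) {m i : ℕ} (hi : i < m) :
    ((List.range m).flatMap fun i => [f i, g i, h i]).getD (3 * i) d = f i ∧
    ((List.range m).flatMap fun i => [f i, g i, h i]).getD (3 * i + 1) d = g i ∧
    ((List.range m).flatMap fun i => [f i, g i, h i]).getD (3 * i + 2) d = h i := by
  induction m with
  | zero => omega
  | succ m ih =>
    have hlen : ((List.range m).flatMap fun i => [f i, g i, h i]).length = 3 * m := by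
      simp [List.length_flatMap, mul_comm]
    rw [List.range_succ, List.flatMap_append, List.flatMap_singleton]
    rcases Nat.lt_succ_iff_lt_or_eq.1 hi with hi | rfl
    · rw [List.getD_append _ _ _ _ (by omega), List.getD_append _ _ _ _ (by omega),
        List.getD_append _ _ _ _ (by omega)]
      exact ih hi
    · rw [List.getD_append_right _ _ _ _ (by omega), List.getD_append_right _ _ _ _ (by omega),
        List.getD_append_right _ _ _ _ (by omega), hlen]
      simp

theorem length_blockU {n : ℕ} (hn : 2 ≤ n) : (blockU n).length = 3 * n - 3 := by
  simp only [blockU, List.length_append, List.length_flatMap, List.length_cons, List.length_nil,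
    List.map_const', List.length_range, List.sum_replicate, smul_eq_mul]
  omega

theorem period_getD_of_lt {n r : ℕ} (hn : 2 ≤ n) (hr : r < 3 * n - 3) :
    (period n).getD r (0, 0) = (blockU n).getD r (0, 0) := by
  have h := length_blockU hn
  rw [period, List.append_assoc, List.getD_append _ _ _ _ (by omega)]

theorem period_getD_blockV {n r j : ℕ} (hn : 2 ≤ n) (hr : r = 3 * n - 3 + j) (hj : j < 4) :
    (period n).getD r (0, 0) = (blockV n).getD j (0, 0) := by
  have h := length_blockU hn
  have h' : (blockV n).length = 4 := rfl
  rw [period, List.append_assoc, List.getD_append_right _ _ _ _ (by omega),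
    List.getD_append _ _ _ _ (by omega)]
  congr 1
  omega

theorem period_getD_blockW {n r j : ℕ} (hn : 2 ≤ n) (hr : r = 3 * n + 1 + j) :
    (period n).getD r (0, 0) = (blockW n).getD j (0, 0) := by
  have h : (blockU n ++ blockV n).length = 3 * n + 1 := by
    rw [List.length_append, length_blockU hn, blockV]
    simp only [List.length_cons, List.length_nil]
    omega
  rw [period, List.getD_append_right _ _ _ _ (by omega)]
  congr 1
  omega

theorem blockU_getD_triple {n i m : ℕ} (h : i + m + 3 = n) :
    (blockU n).getD (3 * i) (0, 0) = (Polynomial.X ^ (m + 3), qInt Polynomial.X (m + 3)) ∧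
    (blockU n).getD (3 * i + 1) (0, 0) =
      (Polynomial.X ^ n, qInt Polynomial.X (i + 2) - Polynomial.X) ∧
    (blockU n).getD (3 * i + 2) (0, 0) = (Polynomial.X ^ (i + 2), 1 - Polynomial.X) := by
  have hlen : ((List.range (n - 2)).flatMap fun i =>
      ([(Polynomial.X ^ (n - i), qInt Polynomial.X (n - i)),
       (Polynomial.X ^ n, qInt Polynomial.X (i + 2) - Polynomial.X),
       (Polynomial.X ^ (i + 2), 1 - Polynomial.X)] : List (ℚ[X] × ℚ[X]))).length =
      3 * (n - 2) := by
    simp [List.length_flatMap, mul_comm]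
  rw [blockU, List.getD_append _ _ _ _ (by omega), List.getD_append _ _ _ _ (by omega),
    List.getD_append _ _ _ _ (by omega), show m + 3 = n - i by omega]
  exact getD_flatMap_range_triple _ _ _ _ (by omega)

theorem blockU_getD_last {n i : ℕ} (h : i + 2 = n) :
    (blockU n).getD (3 * i) (0, 0) = (Polynomial.X ^ 2, qInt Polynomial.X 2) ∧
    (blockU n).getD (3 * i + 1) (0, 0) =
      (Polynomial.X ^ n, qInt Polynomial.X n - Polynomial.X) ∧
    (blockU n).getD (3 * i + 2) (0, 0) = (Polynomial.X ^ n, 1) := by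
  have hlen : ((List.range (n - 2)).flatMap fun i =>
      ([(Polynomial.X ^ (n - i), qInt Polynomial.X (n - i)),
       (Polynomial.X ^ n, qInt Polynomial.X (i + 2) - Polynomial.X),
       (Polynomial.X ^ (i + 2), 1 - Polynomial.X)] : List (ℚ[X] × ℚ[X]))).length =
      3 * i := by
    simp [List.length_flatMap, mul_comm]; omega
  rw [blockU, List.getD_append_right _ _ _ _ (by omega), List.getD_append_right _ _ _ _ (by omega),
    List.getD_append_right _ _ _ _ (by omega), hlen]
  simp

theorem blockW_getD_triple {n i m : ℕ} (h : i + m + 3 = n) :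
    (blockW n).getD (3 * i) (0, 0) =
      (Polynomial.X ^ (m + 3), qInt Polynomial.X (m + 3) - Polynomial.X) ∧
    (blockW n).getD (3 * i + 1) (0, 0) = (Polynomial.X ^ n, qInt Polynomial.X (i + 2)) ∧
    (blockW n).getD (3 * i + 2) (0, 0) = (Polynomial.X ^ (i + 2), 1 - Polynomial.X) := by
  have hlen : ((List.range (n - 2)).flatMap fun i =>
      ([(Polynomial.X ^ (n - i), qInt Polynomial.X (n - i) - Polynomial.X),
       (Polynomial.X ^ n, qInt Polynomial.X (i + 2)),
       (Polynomial.X ^ (i + 2), 1 - Polynomial.X)] : List (ℚ[X] × ℚ[X]))).length =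
      3 * (n - 2) := by
    simp [List.length_flatMap, mul_comm]
  rw [blockW, List.getD_append _ _ _ _ (by omega), List.getD_append _ _ _ _ (by omega),
    List.getD_append _ _ _ _ (by omega), show m + 3 = n - i by omega]
  exact getD_flatMap_range_triple _ _ _ _ (by omega)

theorem blockW_getD_last {n i : ℕ} (h : i + 2 = n) :
    (blockW n).getD (3 * i) (0, 0) = (Polynomial.X ^ 2, 1) := by
  have hlen : ((List.range (n - 2)).flatMap fun i =>
      ([(Polynomial.X ^ (n - i), qInt Polynomial.X (n - i) - Polynomial.X),
       (Polynomial.X ^ n, qInt Polynomial.X (i + 2)),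
       (Polynomial.X ^ (i + 2), 1 - Polynomial.X)] : List (ℚ[X] × ℚ[X]))).length =
      3 * i := by
    simp [List.length_flatMap, mul_comm]; omega
  rw [blockW, List.getD_append_right _ _ _ _ (by omega), hlen]
  simp

/-! ### Degrees and constant terms of the partial denominators -/

theorem natDegree_one_sub_X_le : (1 - Polynomial.X : ℚ[X]).natDegree ≤ 1 := by
  compute_degree

theorem natDegree_qInt_sub_X_le (n : ℕ) :
    (qInt Polynomial.X (n + 2) - Polynomial.X : ℚ[X]).natDegree ≤ n + 1 :=
  (Polynomial.natDegree_sub_le _ _).trans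
    (max_le (natDegree_qInt_succ_le _) (Polynomial.natDegree_X_le.trans n.succ_pos))

theorem eval_zero_qAngle {n : ℕ} (hn : n ≠ 0) : (qAngle n).eval 0 = 1 := by
  simp [qAngle, hn]

/-- The terms of degree `n + 1` cancel: `⟨n⟩_q + q ^ (n + 1) = q [n]_q + 1 - q + q ^ n`. -/
theorem natDegree_qAngle_add_le {n : ℕ} (hn : n ≠ 0) :
    (qAngle n + Polynomial.X ^ (n + 1)).natDegree ≤ n := by
  obtain ⟨n, rfl⟩ := Nat.exists_eq_add_one_of_ne_zero hn
  have e : qAngle (n + 1) + Polynomial.X ^ (n + 1 + 1) =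
      Polynomial.X * qInt Polynomial.X (n + 1) + (1 - Polynomial.X + Polynomial.X ^ (n + 1)) := by
    rw [qAngle]; ring
  rw [e]
  refine Polynomial.natDegree_add_le_of_degree_le ?_ ?_
  · rw [add_comm n 1]
    exact Polynomial.natDegree_mul_le_of_le Polynomial.natDegree_X_le
      (add_comm 1 n ▸ natDegree_qInt_succ_le n)
  · exact Polynomial.natDegree_add_le_of_degree_le (natDegree_one_sub_X_le.trans (by omega))
      (Polynomial.natDegree_X_pow_le _)

theorem natDegree_qAngle_le {n : ℕ} (hn : n ≠ 0) : (qAngle n).natDegree ≤ n + 1 := by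
  rw [← add_sub_cancel_right (qAngle n) (Polynomial.X ^ (n + 1))]
  exact (Polynomial.natDegree_sub_le _ _).trans
    (max_le ((natDegree_qAngle_add_le hn).trans n.le_succ) (Polynomial.natDegree_X_pow_le _))

theorem coe_qAngle (n : ℕ) : ((qAngle n : ℚ[X]) : ℚ⟦X⟧) =
    PowerSeries.X * qInt PowerSeries.X n + (1 + PowerSeries.X ^ n) * (1 - PowerSeries.X) := by
  rw [qAngle]
  push_cast
  rw [coe_qInt]

/-! ### The complete quotients -/

/-- One step of an `H`-fraction: `F` and `F'` are consecutive tails, `t = (a, b)` is the term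
between them, so that `F = a / (b + F')`, and `k`, `k'` are the exponents before and after. -/
structure IsHStep (k : ℕ) (F : ℚ⟦X⟧) (t : ℚ[X] × ℚ[X]) (k' : ℕ) (F' : ℚ⟦X⟧) : Prop where
  exists_num : ∃ v : ℚ, v ≠ 0 ∧ t.1 = -Polynomial.C v * Polynomial.X ^ (k + k' + 2)
  eval_den : t.2.eval 0 = 1
  natDegree_den : t.2.natDegree ≤ k' + 1
  mul_eq : F * (t.2 + F') = t.1

theorem IsHStep.of_X_pow {k e k' : ℕ} {F F' : ℚ⟦X⟧} {b : ℚ[X]} (he : e = k + k' + 2)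
    (h0 : b.eval 0 = 1) (hd : b.natDegree ≤ k' + 1)
    (h : F * ((b : ℚ⟦X⟧) + F') = PowerSeries.X ^ e) : IsHStep k F (Polynomial.X ^ e, b) k' F' :=
  ⟨⟨-1, by norm_num, by simp [he]⟩, h0, hd, by rw [h]; push_cast; rfl⟩

theorem IsHStep.of_neg_X_pow {k e k' : ℕ} {F F' : ℚ⟦X⟧} {b : ℚ[X]} (he : e = k + k' + 2)
    (h0 : b.eval 0 = 1) (hd : b.natDegree ≤ k' + 1)
    (h : F * ((b : ℚ⟦X⟧) + F') = -PowerSeries.X ^ e) : IsHStep k F (-Polynomial.X ^ e, b) k' F' :=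
  ⟨⟨1, by norm_num, by simp [he]⟩, h0, hd, by rw [h]; push_cast; rfl⟩

/-- `Stage n ψ r k F` lists the tails of the periodic continued fraction: `F` is the value
of the part which begins with the term of index `r` of the period, expressed through the remainder
`ψ` of `Φ_n`, and `k` is the exponent of the `H`-fraction belonging to the preceding term.
The series `[m + 2]_q + q ^ (n + m + 2) ψ` with `i + m + 2 = n` is the shift `Φ_n^(i)`. -/
inductive Stage (n : ℕ) (ψ : ℚ⟦X⟧) : ℕ → ℕ → ℚ⟦X⟧ → Prop
  | u_first (i m : ℕ) (h : i + m + 2 = n) : Stage n ψ (3 * i) 0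
      ((qInt PowerSeries.X (m + 2) + PowerSeries.X ^ (n + m + 2) * ψ)⁻¹ - (1 - PowerSeries.X))
  | u_second (i m : ℕ) (h : i + m + 2 = n) : Stage n ψ (3 * i + 1) m
      (PowerSeries.X ^ n * ψ * (1 - (1 - PowerSeries.X) * PowerSeries.X ^ n * ψ)⁻¹)
  | u_third (i m : ℕ) (h : i + m + 2 = n) : Stage n ψ (3 * i + 2) i
      (PowerSeries.X ^ (i + 2) *
        (qInt PowerSeries.X (m + 1) + PowerSeries.X ^ (n + m + 1) * ψ))
  | v_first : Stage n ψ (3 * n - 3) 0 ((1 + PowerSeries.X ^ (n + 1) * ψ)⁻¹ - 1)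
  | v_second : Stage n ψ (3 * n - 2) (n - 1) (PowerSeries.X ^ (2 * n + 1) * ψ)
  | v_third : Stage n ψ (3 * n - 1) n (PowerSeries.X ^ (2 * n + 1) * ψ)
  | v_fourth : Stage n ψ (3 * n) (n - 1)
      (PowerSeries.X ^ (2 * n + 1) * ψ - PowerSeries.X ^ (n + 1))
  | w_first (i m : ℕ) (h : i + m + 2 = n) : Stage n ψ (3 * n + 1 + 3 * i) 0
      (PowerSeries.X ^ (m + 2) * ψ *
        (1 - qInt PowerSeries.X (i + 1) * PowerSeries.X ^ (m + 2) * ψ)⁻¹)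
  | w_second (i m : ℕ) (h : i + m + 3 = n) : Stage n ψ (3 * n + 1 + (3 * i + 1)) (m + 1)
      (PowerSeries.X ^ n * (1 - PowerSeries.X + PowerSeries.X ^ (n + 1) * ψ))
  | w_third (i m : ℕ) (h : i + m + 3 = n) : Stage n ψ (3 * n + 1 + (3 * i + 2)) i
      ((1 - PowerSeries.X + PowerSeries.X ^ (n + 1) * ψ)⁻¹ - qInt PowerSeries.X (i + 2))

theorem Stage.constantCoeff_eq_zero {n r k : ℕ} {ψ F : ℚ⟦X⟧} (hn : 2 ≤ n)
    (h : Stage n ψ r k F) : PowerSeries.constantCoeff F = 0 := by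
  have hn0 : n ≠ 0 := by omega
  cases h <;> simp [constantCoeff_qInt_succ, hn0]

theorem Stage.cast_mod {n r r' k p : ℕ} {ψ F : ℚ⟦X⟧} (h : Stage n ψ r k F) (hr : r = r' + 1)
    (hlt : r < p) : Stage n ψ ((r' + 1) % p) k F := by
  rwa [← hr, Nat.mod_eq_of_lt hlt]

/-! ### The equations between consecutive complete quotients -/

section Steps

variable {n i m : ℕ} {ψ : ℚ⟦X⟧}

theorem u_first_mul (h : i + m + 2 = n) :
    ((qInt PowerSeries.X (m + 2) + PowerSeries.X ^ (n + m + 2) * ψ)⁻¹ - (1 - PowerSeries.X)) *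
      (qInt PowerSeries.X (m + 2) +
        PowerSeries.X ^ n * ψ * (1 - (1 - PowerSeries.X) * PowerSeries.X ^ n * ψ)⁻¹) =
      PowerSeries.X ^ (m + 2) := by
  have hD : PowerSeries.constantCoeff
      (qInt PowerSeries.X (m + 2) + PowerSeries.X ^ (n + m + 2) * ψ) ≠ 0 := by
    simp [constantCoeff_qInt_succ]
  have hE : PowerSeries.constantCoeff
      (1 - (1 - PowerSeries.X) * PowerSeries.X ^ n * ψ) ≠ 0 := by
    simp [show n ≠ 0 by omega]
  have hI := PowerSeries.mul_inv_cancel _ hD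
  have hJ := PowerSeries.mul_inv_cancel _ hE
  have g := one_sub_mul_qInt (PowerSeries.X : ℚ⟦X⟧) (m + 2)
  generalize (qInt PowerSeries.X (m + 2) + PowerSeries.X ^ (n + m + 2) * ψ)⁻¹ = I at *
  generalize (1 - (1 - PowerSeries.X) * PowerSeries.X ^ n * ψ)⁻¹ = J at *
  have h1 : I - (1 - PowerSeries.X) = PowerSeries.X ^ (m + 2) *
      (1 - (1 - PowerSeries.X) * PowerSeries.X ^ n * ψ) * I := by
    linear_combination (1 - PowerSeries.X) * hI - I * g
  have h2 : qInt PowerSeries.X (m + 2) + PowerSeries.X ^ n * ψ * J =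
      (qInt PowerSeries.X (m + 2) + PowerSeries.X ^ (n + m + 2) * ψ) * J := by
    linear_combination (-qInt PowerSeries.X (m + 2)) * hJ - PowerSeries.X ^ n * ψ * J * g
  rw [h1, h2]
  linear_combination PowerSeries.X ^ (m + 2) * hI +
    PowerSeries.X ^ (m + 2) * (qInt PowerSeries.X (m + 2) + PowerSeries.X ^ (n + m + 2) * ψ) *
      I * hJ

theorem u_second_mul (hψ : IsMetallicRemainder n ψ) (h : i + m + 2 = n) :
    PowerSeries.X ^ n * ψ * (1 - (1 - PowerSeries.X) * PowerSeries.X ^ n * ψ)⁻¹ *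
      (qInt PowerSeries.X (i + 2) - PowerSeries.X + PowerSeries.X ^ (i + 2) *
        (qInt PowerSeries.X (m + 1) + PowerSeries.X ^ (n + m + 1) * ψ)) =
      PowerSeries.X ^ n := by
  have hE : PowerSeries.constantCoeff
      (1 - (1 - PowerSeries.X) * PowerSeries.X ^ n * ψ) ≠ 0 := by
    simp [show n ≠ 0 by omega]
  have hJ := PowerSeries.mul_inv_cancel _ hE
  generalize (1 - (1 - PowerSeries.X) * PowerSeries.X ^ n * ψ)⁻¹ = J at *
  have g1 := qInt_add (PowerSeries.X : ℚ⟦X⟧) (i + 2) (m + 1)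
  have g2 := qInt_add (PowerSeries.X : ℚ⟦X⟧) 1 n
  rw [show i + 2 + (m + 1) = 1 + n by omega, g2, qInt_succ _ 0, qInt_zero] at g1
  have hp : (PowerSeries.X : ℚ⟦X⟧) ^ (2 * n + 1) =
      PowerSeries.X ^ (i + 2) * PowerSeries.X ^ (n + m + 1) := by
    rw [← pow_add]; congr 1; omega
  rw [IsMetallicRemainder, hp] at hψ
  linear_combination PowerSeries.X ^ n * J * hψ + PowerSeries.X ^ n * hJ -
    PowerSeries.X ^ n * J * ψ * g1

theorem u_third_mul :
    PowerSeries.X ^ (i + 2) *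
        (qInt PowerSeries.X (m + 1 + 1) + PowerSeries.X ^ (n + (m + 1) + 1) * ψ) *
      (1 - PowerSeries.X + ((qInt PowerSeries.X (m + 2) + PowerSeries.X ^ (n + m + 2) * ψ)⁻¹ -
        (1 - PowerSeries.X))) = PowerSeries.X ^ (i + 2) := by
  have hD : PowerSeries.constantCoeff
      (qInt PowerSeries.X (m + 2) + PowerSeries.X ^ (n + m + 2) * ψ) ≠ 0 := by
    simp [constantCoeff_qInt_succ]
  rw [add_sub_cancel, mul_assoc, show n + (m + 1) + 1 = n + m + 2 by omega,
    PowerSeries.mul_inv_cancel _ hD, mul_one]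

theorem u_last_mul (h : i + 2 = n) :
    PowerSeries.X ^ (i + 2) *
        (qInt PowerSeries.X (0 + 1) + PowerSeries.X ^ (n + 0 + 1) * ψ) *
      (1 + ((1 + PowerSeries.X ^ (n + 1) * ψ)⁻¹ - 1)) = PowerSeries.X ^ n := by
  have hD : PowerSeries.constantCoeff (1 + PowerSeries.X ^ (n + 1) * ψ) ≠ 0 := by simp
  rw [add_sub_cancel, mul_assoc, qInt_succ, qInt_zero, zero_add, pow_zero, add_zero,
    PowerSeries.mul_inv_cancel _ hD, mul_one, h]

theorem v_first_mul (hψ : IsMetallicRemainder n ψ) :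
    ((1 + PowerSeries.X ^ (n + 1) * ψ)⁻¹ - 1) *
      (((qAngle n : ℚ[X]) : ℚ⟦X⟧) + PowerSeries.X ^ (n + 1) + PowerSeries.X ^ (2 * n + 1) * ψ) =
      -PowerSeries.X ^ (n + 1) := by
  have hD : PowerSeries.constantCoeff (1 + PowerSeries.X ^ (n + 1) * ψ) ≠ 0 := by simp
  have hI := PowerSeries.mul_inv_cancel _ hD
  generalize (1 + PowerSeries.X ^ (n + 1) * ψ)⁻¹ = I at *
  rw [IsMetallicRemainder, ← coe_qAngle] at hψ
  have h1 : I - 1 = -I * PowerSeries.X ^ (n + 1) * ψ := by linear_combination hI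
  rw [h1]
  linear_combination (-I * PowerSeries.X ^ (n + 1)) * hψ - PowerSeries.X ^ (n + 1) * hI

theorem v_second_mul (hψ : IsMetallicRemainder n ψ) :
    PowerSeries.X ^ (2 * n + 1) * ψ *
      (((qAngle n : ℚ[X]) : ℚ⟦X⟧) + PowerSeries.X ^ (2 * n + 1) * ψ) =
      PowerSeries.X ^ (2 * n + 1) := by
  rw [IsMetallicRemainder, ← coe_qAngle] at hψ
  linear_combination PowerSeries.X ^ (2 * n + 1) * hψ

theorem v_fourth_mul (hn : n ≠ 0) :
    (PowerSeries.X ^ (2 * n + 1) * ψ - PowerSeries.X ^ (n + 1)) *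
      (1 + PowerSeries.X ^ n * ψ *
        (1 - qInt PowerSeries.X (0 + 1) * PowerSeries.X ^ n * ψ)⁻¹) =
      -PowerSeries.X ^ (n + 1) := by
  rw [qInt_succ, qInt_zero, zero_add, pow_zero, one_mul]
  have hD : PowerSeries.constantCoeff (1 - PowerSeries.X ^ n * ψ) ≠ 0 := by simp [hn]
  linear_combination (-PowerSeries.X ^ (n + 1) * PowerSeries.X ^ n * ψ) *
    PowerSeries.mul_inv_cancel _ hD

theorem w_first_mul (hψ : IsMetallicRemainder n ψ) (h : i + m + 3 = n) :
    PowerSeries.X ^ (m + 3) * ψ *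
        (1 - qInt PowerSeries.X (i + 1) * PowerSeries.X ^ (m + 3) * ψ)⁻¹ *
      (qInt PowerSeries.X (m + 3) - PowerSeries.X +
        PowerSeries.X ^ n * (1 - PowerSeries.X + PowerSeries.X ^ (n + 1) * ψ)) =
      PowerSeries.X ^ (m + 3) := by
  have hD : PowerSeries.constantCoeff
      (1 - qInt PowerSeries.X (i + 1) * PowerSeries.X ^ (m + 3) * ψ) ≠ 0 := by simp
  have hI := PowerSeries.mul_inv_cancel _ hD
  generalize (1 - qInt PowerSeries.X (i + 1) * PowerSeries.X ^ (m + 3) * ψ)⁻¹ = I at *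
  have g1 := qInt_add (PowerSeries.X : ℚ⟦X⟧) (m + 3) (i + 1)
  have g2 := qInt_add (PowerSeries.X : ℚ⟦X⟧) 1 n
  rw [show m + 3 + (i + 1) = 1 + n by omega, g2, qInt_succ _ 0, qInt_zero] at g1
  rw [IsMetallicRemainder] at hψ
  linear_combination PowerSeries.X ^ (m + 3) * I * hψ + PowerSeries.X ^ (m + 3) * hI -
    PowerSeries.X ^ (m + 3) * I * ψ * g1

theorem w_second_mul :
    PowerSeries.X ^ n * (1 - PowerSeries.X + PowerSeries.X ^ (n + 1) * ψ) *
      (qInt PowerSeries.X (i + 2) + ((1 - PowerSeries.X + PowerSeries.X ^ (n + 1) * ψ)⁻¹ -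
        qInt PowerSeries.X (i + 2))) = PowerSeries.X ^ n := by
  have hD : PowerSeries.constantCoeff
      (1 - PowerSeries.X + PowerSeries.X ^ (n + 1) * ψ) ≠ 0 := by simp
  rw [add_sub_cancel, mul_assoc, PowerSeries.mul_inv_cancel _ hD, mul_one]

theorem w_third_mul (h : i + m + 3 = n) :
    ((1 - PowerSeries.X + PowerSeries.X ^ (n + 1) * ψ)⁻¹ - qInt PowerSeries.X (i + 2)) *
      (1 - PowerSeries.X + PowerSeries.X ^ (m + 2) * ψ *
        (1 - qInt PowerSeries.X (i + 1 + 1) * PowerSeries.X ^ (m + 2) * ψ)⁻¹) =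
      PowerSeries.X ^ (i + 2) := by
  have hE : PowerSeries.constantCoeff
      (1 - PowerSeries.X + PowerSeries.X ^ (n + 1) * ψ) ≠ 0 := by simp
  have hD : PowerSeries.constantCoeff
      (1 - qInt PowerSeries.X (i + 2) * PowerSeries.X ^ (m + 2) * ψ) ≠ 0 := by simp
  have hI := PowerSeries.mul_inv_cancel _ hE
  have hJ := PowerSeries.mul_inv_cancel _ hD
  have g := one_sub_mul_qInt (PowerSeries.X : ℚ⟦X⟧) (i + 2)
  have hp : (PowerSeries.X : ℚ⟦X⟧) ^ (n + 1) =
      PowerSeries.X ^ (i + 2) * PowerSeries.X ^ (m + 2) := by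
    rw [← pow_add]; congr 1; omega
  rw [show i + 1 + 1 = i + 2 from rfl]
  rw [hp] at hI ⊢
  generalize (1 - PowerSeries.X +
    PowerSeries.X ^ (i + 2) * PowerSeries.X ^ (m + 2) * ψ)⁻¹ = I at *
  generalize (1 - qInt PowerSeries.X (i + 2) * PowerSeries.X ^ (m + 2) * ψ)⁻¹ = J at *
  have h1 : I - qInt PowerSeries.X (i + 2) = PowerSeries.X ^ (i + 2) *
      (1 - qInt PowerSeries.X (i + 2) * PowerSeries.X ^ (m + 2) * ψ) * I := by
    linear_combination qInt PowerSeries.X (i + 2) * hI - I * g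
  have h2 : 1 - PowerSeries.X + PowerSeries.X ^ (m + 2) * ψ * J =
      (1 - PowerSeries.X + PowerSeries.X ^ (i + 2) * PowerSeries.X ^ (m + 2) * ψ) * J := by
    linear_combination (-(1 - PowerSeries.X)) * hJ - PowerSeries.X ^ (m + 2) * ψ * J * g
  rw [h1, h2]
  linear_combination PowerSeries.X ^ (i + 2) * hJ + PowerSeries.X ^ (i + 2) *
    (1 - qInt PowerSeries.X (i + 2) * PowerSeries.X ^ (m + 2) * ψ) * J * hI

theorem w_last_mul (hψ : IsMetallicRemainder n ψ) (h : i + 2 = n) :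
    PowerSeries.X ^ 2 * ψ *
        (1 - qInt PowerSeries.X (i + 1) * PowerSeries.X ^ 2 * ψ)⁻¹ *
      (1 + ((qInt PowerSeries.X n + PowerSeries.X ^ (2 * n) * ψ)⁻¹ - (1 - PowerSeries.X))) =
      PowerSeries.X ^ 2 := by
  have hE : PowerSeries.constantCoeff
      (1 - qInt PowerSeries.X (i + 1) * PowerSeries.X ^ 2 * ψ) ≠ 0 := by simp
  have hD : PowerSeries.constantCoeff
      (qInt PowerSeries.X n + PowerSeries.X ^ (2 * n) * ψ) ≠ 0 := by
    subst h
    simp [constantCoeff_qInt_succ]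
  have hI := PowerSeries.mul_inv_cancel _ hD
  have hJ := PowerSeries.mul_inv_cancel _ hE
  have h1 := hψ.mul_qInt_mul_add_one
  have g := qInt_add (PowerSeries.X : ℚ⟦X⟧) 1 (i + 1)
  rw [show 1 + (i + 1) = n by omega, qInt_succ _ 0, qInt_zero, zero_add, pow_zero, pow_one] at g
  generalize (1 - qInt PowerSeries.X (i + 1) * PowerSeries.X ^ 2 * ψ)⁻¹ = J at *
  generalize (qInt PowerSeries.X n + PowerSeries.X ^ (2 * n) * ψ)⁻¹ = I at *
  have h2 : ψ * (PowerSeries.X * qInt PowerSeries.X n + I) = 1 := by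
    linear_combination I * h1 + (1 - ψ * PowerSeries.X * qInt PowerSeries.X n) * hI
  linear_combination PowerSeries.X ^ 2 * J * h2 + PowerSeries.X ^ 2 * hJ -
    PowerSeries.X ^ 3 * ψ * J * g

end Steps

/-- Each tail in the list is followed by the next one, the end of the period leading back to its
beginning. -/
theorem Stage.exists_step {n r k : ℕ} {ψ F : ℚ⟦X⟧} (hn : 2 ≤ n) (hψ : IsMetallicRemainder n ψ)
    (hF : Stage n ψ r k F) :
    ∃ (k' : ℕ) (F' : ℚ⟦X⟧), Stage n ψ ((r + 1) % (6 * n - 4)) k' F' ∧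
      IsHStep k F ((period n).getD r (0, 0)) k' F' := by
  have hn0 : n ≠ 0 := by omega
  cases hF with
  | u_first i m h =>
    refine ⟨_, _, (Stage.u_second i m h).cast_mod rfl (by omega), ?_⟩
    rw [period_getD_of_lt hn (by omega)]
    have e : (blockU n).getD (3 * i) (0, 0) =
        (Polynomial.X ^ (m + 2), qInt Polynomial.X (m + 2)) := by
      obtain _ | m := m
      · exact (blockU_getD_last h).1
      · exact (blockU_getD_triple h).1
    rw [e]
    refine .of_X_pow (by omega) (eval_zero_qInt_succ _) (natDegree_qInt_succ_le _) ?_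
    rw [coe_qInt]
    exact u_first_mul h
  | u_second i _ h =>
    refine ⟨_, _, (Stage.u_third i k h).cast_mod rfl (by omega), ?_⟩
    rw [period_getD_of_lt hn (by omega)]
    have e : (blockU n).getD (3 * i + 1) (0, 0) =
        (Polynomial.X ^ n, qInt Polynomial.X (i + 2) - Polynomial.X) := by
      obtain _ | k := k
      · rw [(blockU_getD_last h).2.1, h]
      · exact (blockU_getD_triple h).2.1
    rw [e]
    refine .of_X_pow (by omega) (by simp [eval_zero_qInt_succ]) (natDegree_qInt_sub_X_le _) ?_
    rw [Polynomial.coe_sub, coe_qInt, Polynomial.coe_X]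
    exact u_second_mul hψ h
  | u_third _ m h =>
    obtain _ | m := m
    · refine ⟨_, _, (Stage.v_first).cast_mod (by omega) (by omega), ?_⟩
      rw [period_getD_of_lt hn (by omega), (blockU_getD_last h).2.2]
      refine .of_X_pow (by omega) (by simp) (by simp) ?_
      rw [Polynomial.coe_one]
      exact u_last_mul h
    · refine ⟨_, _, (Stage.u_first (k + 1) m (by omega)).cast_mod (by omega) (by omega), ?_⟩
      rw [period_getD_of_lt hn (by omega), (blockU_getD_triple h).2.2]
      refine .of_X_pow (by omega) (by simp) natDegree_one_sub_X_le ?_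
      rw [Polynomial.coe_sub, Polynomial.coe_one, Polynomial.coe_X]
      exact u_third_mul
  | v_first =>
    refine ⟨_, _, (Stage.v_second).cast_mod (by omega) (by omega), ?_⟩
    rw [period_getD_blockV (j := 0) hn (by omega) (by omega)]
    refine .of_neg_X_pow (by omega) (by simp [eval_zero_qAngle hn0])
      ((natDegree_qAngle_add_le hn0).trans (by omega)) ?_
    rw [Polynomial.coe_add, Polynomial.coe_pow, Polynomial.coe_X]
    exact v_first_mul hψ
  | v_second =>
    refine ⟨_, _, (Stage.v_third).cast_mod (by omega) (by omega), ?_⟩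
    rw [period_getD_blockV (j := 1) hn (by omega) (by omega)]
    exact .of_X_pow (by omega) (eval_zero_qAngle hn0) (natDegree_qAngle_le hn0) (v_second_mul hψ)
  | v_third =>
    refine ⟨_, _, (Stage.v_fourth).cast_mod (by omega) (by omega), ?_⟩
    rw [period_getD_blockV (j := 2) hn (by omega) (by omega)]
    refine .of_X_pow (by omega) (by simp [eval_zero_qAngle hn0])
      ((natDegree_qAngle_add_le hn0).trans (by omega)) ?_
    rw [Polynomial.coe_add, Polynomial.coe_pow, Polynomial.coe_X, add_add_sub_cancel]
    exact v_second_mul hψ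
  | v_fourth =>
    refine ⟨_, _, (Stage.w_first 0 (n - 2) (by omega)).cast_mod (by omega) (by omega), ?_⟩
    rw [period_getD_blockV (j := 3) hn (by omega) (by omega)]
    refine .of_neg_X_pow (by omega) (by simp) (by simp) ?_
    rw [Polynomial.coe_one, Nat.sub_add_cancel hn]
    exact v_fourth_mul hn0
  | w_first i m h =>
    rw [period_getD_blockW hn rfl]
    obtain _ | m := m
    · have e : (3 * n + 1 + 3 * i + 1) % (6 * n - 4) = 3 * 0 := by
        rw [show 3 * n + 1 + 3 * i + 1 = 6 * n - 4 by omega, Nat.mod_self]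
      refine ⟨_, _, e ▸ Stage.u_first 0 i (by omega), ?_⟩
      rw [blockW_getD_last h]
      refine .of_X_pow (by omega) (by simp) (by simp) ?_
      rw [Polynomial.coe_one, h, show n + i + 2 = 2 * n by omega]
      exact w_last_mul hψ h
    · refine ⟨_, _, (Stage.w_second i m h).cast_mod (by omega) (by omega), ?_⟩
      rw [(blockW_getD_triple h).1]
      refine .of_X_pow (by omega) (by simp [eval_zero_qInt_succ]) (natDegree_qInt_sub_X_le _) ?_
      rw [Polynomial.coe_sub, coe_qInt, Polynomial.coe_X]
      exact w_first_mul hψ h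
  | w_second i m h =>
    refine ⟨_, _, (Stage.w_third i m h).cast_mod (by omega) (by omega), ?_⟩
    rw [period_getD_blockW hn rfl, (blockW_getD_triple h).2.1]
    refine .of_X_pow (by omega) (eval_zero_qInt_succ _) (natDegree_qInt_succ_le _) ?_
    rw [coe_qInt]
    exact w_second_mul
  | w_third _ m h =>
    refine ⟨_, _, (Stage.w_first (k + 1) m (by omega)).cast_mod (by omega) (by omega), ?_⟩
    rw [period_getD_blockW hn rfl, (blockW_getD_triple h).2.2]
    refine .of_X_pow (by omega) (by simp) natDegree_one_sub_X_le ?_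
    rw [Polynomial.coe_sub, Polynomial.coe_one, Polynomial.coe_X]
    exact w_third_mul h

/-! ### `H`-fractions from the list of tails -/

/-- Dependent choice along an invariant `P` which depends on the index. -/
theorem exists_seq_of_exists_next {σ : Type*} {P : ℕ → σ → Prop} {R : ℕ → σ → σ → Prop} {x : σ}
    (hx : P 0 x) (h : ∀ i y, P i y → ∃ z, P (i + 1) z ∧ R i y z) :
    ∃ s : ℕ → σ, s 0 = x ∧ ∀ i, P i (s i) ∧ R i (s i) (s (i + 1)) := by
  choose f hf using h
  let g : (i : ℕ) → {y // P i y} :=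
    fun i => Nat.rec ⟨x, hx⟩ (fun i y => ⟨f i y.1 y.2, (hf i y.1 y.2).1⟩) i
  exact ⟨fun i => (g i).1, rfl, fun i => ⟨(g i).2, (hf i _ (g i).2).2⟩⟩

/-- If `F` is the tail of the periodic continued fraction after the term of index `m`, then
`G = c / (β_m + F)` has the `H`-fraction obtained by cutting at `m`. -/
theorem Stage.hasHFraction {n m r k : ℕ} {ψ F G : ℚ⟦X⟧} {c : ℚ[X]} (hn : 2 ≤ n)
    (hψ : IsMetallicRemainder n ψ) (hF : Stage n ψ r k F) (hr : m % (6 * n - 4) = r)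
    (hc : c = Polynomial.X ^ k) (h0 : (hDen n m).eval 0 = 1) (hd : (hDen n m).natDegree ≤ k + 1)
    (hG : G * (hDen n m + F) = c) :
    HasHFraction G (cutNum (hNum n) m c) (cutDen (hDen n) m) := by
  subst hr
  obtain ⟨s, hs0, hs⟩ := exists_seq_of_exists_next (σ := ℕ × ℚ⟦X⟧)
    (P := fun i y => Stage n ψ ((m + i) % (6 * n - 4)) y.1 y.2)
    (R := fun i y z => IsHStep y.1 y.2 (hTerm n (m + i + 1)) z.1 z.2) (x := (k, F)) hF
    fun i y hy => by
      obtain ⟨k', F', h₁, h₂⟩ := hy.exists_step hn hψ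
      refine ⟨(k', F'), ?_, h₂⟩
      rwa [Nat.mod_add_mod] at h₁
  have hden (i : ℕ) : (cutDen (hDen n) m i).eval 0 = 1 ∧
      (cutDen (hDen n) m i).natDegree ≤ (s i).1 + 1 := by
    cases i with
    | zero => rw [hs0]; exact ⟨h0, hd⟩
    | succ i => exact ⟨(hs i).2.eval_den, (hs i).2.natDegree_den⟩
  refine ⟨?_, ?_⟩
  · choose v hv hv' using fun i => (hs i).2.exists_num
    obtain ⟨w, hw0, hw⟩ : ∃ w : ℕ → ℚ, w 0 = 1 ∧ ∀ i, w (i + 1) = v i :=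
      ⟨fun i => Nat.rec 1 (fun i _ => v i) i, rfl, fun _ => rfl⟩
    refine ⟨w, fun i => (s i).1, ?_, ?_, fun i => ?_, hden⟩
    · rintro (_ | i)
      · rw [hw0]; exact one_ne_zero
      · rw [hw]; exact hv i
    · beta_reduce
      rw [hs0, hw0, Polynomial.C_1, one_mul]
      exact hc
    · rw [hw]
      exact hv' i
  · refine cfConverges_of_tails (F := fun i => (s i).2)
      (fun i => (hs i).1.constantCoeff_eq_zero hn) (fun i => (hden i).1) ?_
      (fun i => (hs i).2.mul_eq)
    rw [hs0]
    exact hG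

theorem hDen_of_lt {n j : ℕ} (h : j < 6 * n - 4) :
    hDen n (j + 1) = ((period n).getD j (0, 0)).2 := by
  rw [hDen, hTerm, Nat.mod_eq_of_lt h]

theorem shift_metallic {n l m : ℕ} (h : l + m = n) (ψ : ℚ⟦X⟧) :
    shift (qInt PowerSeries.X n + PowerSeries.X ^ (2 * n) * ψ) l =
      qInt PowerSeries.X m + PowerSeries.X ^ (n + m) * ψ := by
  have e : qInt PowerSeries.X n + PowerSeries.X ^ (2 * n) * ψ = qInt PowerSeries.X l +
      PowerSeries.X ^ l * (qInt PowerSeries.X m + PowerSeries.X ^ (n + m) * ψ) := by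
    rw [mul_add, ← mul_assoc, ← pow_add, ← add_assoc, ← qInt_add, h,
      show l + (n + m) = 2 * n by omega]
  rw [e, shift_qInt_add_X_pow_mul le_rfl]

end QMetallic

theorem mainTheorem7 (n : ℕ) (hn : 2 ≤ n) :
    QMetallic.IsQMetallic n (QMetallic.qMetallic n) ∧
    QMetallic.HasHFraction (QMetallic.qMetallic n) (QMetallic.hNum n) (QMetallic.hDen n) ∧
    (∀ ℓ : ℕ, 1 ≤ ℓ → ℓ ≤ n - 1 →
      QMetallic.HasHFraction (QMetallic.shift (QMetallic.qMetallic n) ℓ)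
        (QMetallic.cutNum (QMetallic.hNum n) (3 * ℓ) 1)
        (QMetallic.cutDen (QMetallic.hDen n) (3 * ℓ))) ∧
    QMetallic.HasHFraction (QMetallic.shift (QMetallic.qMetallic n) n)
      (QMetallic.cutNum (QMetallic.hNum n) (3 * n - 1) (Polynomial.X ^ n))
      (QMetallic.cutDen (QMetallic.hDen n) (3 * n - 1)) ∧
    QMetallic.HasHFraction (QMetallic.shift (QMetallic.qMetallic n) (n + 1))
      (QMetallic.cutNum (QMetallic.hNum n) (3 * n) (Polynomial.X ^ (n - 1)))
      (QMetallic.cutDen (QMetallic.hDen n) (3 * n)) := by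
  open QMetallic in
  have hn0 : n ≠ 0 := by omega
  obtain ⟨ψ, hψ⟩ := exists_isMetallicRemainder hn0
  have hΦ := hψ.isQMetallic hn0
  have hM := isQMetallic_qMetallic hΦ
  refine ⟨hM, ?_⟩
  rw [isQMetallic_unique hM hΦ]
  -- The cuts after the first term and after the terms `(q ^ (i + 2), 1 - q)` of `U_n`.
  have hcut (m : ℕ) (hm : 2 ≤ m) (l : ℕ) (hl : l + m = n)
      (hβ : hDen n (3 * l) = 1 - Polynomial.X) :
      HasHFraction (shift (qInt PowerSeries.X n + PowerSeries.X ^ (2 * n) * ψ) l)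
        (cutNum (hNum n) (3 * l) 1) (cutDen (hDen n) (3 * l)) := by
    obtain ⟨m, rfl⟩ := Nat.exists_eq_add_of_le' hm
    have hD : PowerSeries.constantCoeff
        (qInt PowerSeries.X (m + 2) + PowerSeries.X ^ (n + m + 2) * ψ) ≠ 0 := by
      simp [constantCoeff_qInt_succ]
    rw [shift_metallic hl]
    refine (Stage.u_first l m hl).hasHFraction hn hψ (Nat.mod_eq_of_lt (by omega))
      (pow_zero _).symm (by simp [hβ]) (hβ ▸ natDegree_one_sub_X_le) ?_
    rw [hβ, Polynomial.coe_sub, Polynomial.coe_one, Polynomial.coe_X, add_sub_cancel, ← add_assoc,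
      PowerSeries.mul_inv_cancel _ hD]
  refine ⟨?_, ?_, ?_, ?_⟩
  · have h := hcut n hn 0 (zero_add n) rfl
    have e₁ : cutNum (hNum n) (3 * 0) 1 = hNum n := by
      ext1 i
      cases i with
      | zero => rfl
      | succ i => simp [cutNum]
    have e₂ : cutDen (hDen n) (3 * 0) = hDen n := by
      ext1 i
      simp [cutDen]
    have e₃ (F : ℚ⟦X⟧) : shift F 0 = F := by
      ext i
      simp [shift]
    rwa [e₁, e₂, e₃] at h
  · intro l hl hl'
    obtain ⟨l, rfl⟩ := Nat.exists_eq_add_of_le' hl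
    obtain h | h := Nat.lt_or_eq_of_le hl'
    · refine hcut (n - (l + 1)) (by omega) (l + 1) (by omega) ?_
      rw [mul_add, hDen_of_lt (j := 3 * l + 2) (by omega), period_getD_of_lt hn (by omega),
        (blockU_getD_triple (m := n - 3 - l) (by omega)).2.2]
    -- The cut after the last term of `U_n`, whose denominator is `1` instead of `1 - q`.
    · have hβ : hDen n (3 * (l + 1)) = 1 := by
        rw [mul_add, hDen_of_lt (j := 3 * l + 2) (by omega), period_getD_of_lt hn (by omega),
          (blockU_getD_last (by omega)).2.2]
      have hD : PowerSeries.constantCoeff (1 + PowerSeries.X ^ (n + 1) * ψ) ≠ 0 := by simp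
      rw [shift_metallic (m := 1) (by omega)]
      refine (Stage.v_first).hasHFraction hn hψ
        ((Nat.mod_eq_of_lt (by omega)).trans (by omega)) (pow_zero _).symm
        (by simp [hβ]) (by simp [hβ]) ?_
      rw [hβ, Polynomial.coe_one, add_sub_cancel, qInt_succ, qInt_zero, zero_add, pow_zero,
        PowerSeries.mul_inv_cancel _ hD]
  · have hβ : hDen n (3 * n - 1) = qAngle n := by
      obtain ⟨j, hj⟩ : ∃ j, 3 * n - 1 = j + 1 := ⟨3 * n - 2, by omega⟩
      rw [hj, hDen_of_lt (by omega), period_getD_blockV (j := 1) hn (by omega) (by omega)]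
      rfl
    rw [shift_metallic (m := 0) (by omega)]
    refine (Stage.v_third).hasHFraction hn hψ (Nat.mod_eq_of_lt (by omega)) rfl
      (by rw [hβ, eval_zero_qAngle hn0]) (hβ ▸ natDegree_qAngle_le hn0) ?_
    rw [IsMetallicRemainder, ← coe_qAngle] at hψ
    rw [hβ, qInt_zero, zero_add, add_zero, mul_assoc, hψ, mul_one, Polynomial.coe_pow,
      Polynomial.coe_X]
  · have hβ : hDen n (3 * n) = qAngle n + Polynomial.X ^ (n + 1) := by
      obtain ⟨j, hj⟩ : ∃ j, 3 * n = j + 1 := ⟨3 * n - 1, by omega⟩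
      rw [hj, hDen_of_lt (by omega), period_getD_blockV (j := 2) hn (by omega) (by omega)]
      rfl
    rw [show 2 * n = n + 1 + (n - 1) by omega, pow_add, mul_assoc,
      shift_qInt_add_X_pow_mul n.le_succ]
    refine (Stage.v_fourth).hasHFraction hn hψ (Nat.mod_eq_of_lt (by omega)) rfl
      (by simp [hβ, eval_zero_qAngle hn0])
      (hβ ▸ (natDegree_qAngle_add_le hn0).trans (by omega)) ?_
    rw [IsMetallicRemainder, ← coe_qAngle] at hψ
    rw [hβ, Polynomial.coe_add, Polynomial.coe_pow, Polynomial.coe_X, add_add_sub_cancel,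
      mul_assoc, hψ, mul_one, Polynomial.coe_pow, Polynomial.coe_X]
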